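/- Let $\Gamma=\langle a,b,t \mid tat^{-1}=ab,\ tbt^{-1}=bab\rangle$ be the fundamental group of the complement of the figure eight knot. Let $X(\Gamma,\mathrm{SL}(2,\mathbb{C}))$ be its variety of characters: its points are the characters $\chi_\rho(\gamma)=\operatorname{tr}\rho(\gamma)$ of representations $\rho\colon\Gamma\to\mathrm{SL}(2,\mathbb{C})$, and its coordinate ring is the algebra of functions generated by the trace functions $\chi\mapsto\chi(\gamma)$, $\gamma\in\Gamma$. Then $x_1(\chi)=\chi(a)$, $x_2(\chi)=\chi(b)$ and $y_0(\chi)=\chi(t)$ are coordinates for $X(\Gamma,\mathrm{SL}(2,\mathbb{C}))$, that is, they generate its coordinate ring, so that $\chi\mapsto(x_1(\chi),x_2(\chi),y_0(\chi))$ embeds it in $\mathbb{C}^3$. The variety $X(\Gamma,\mathrm{SL}(2,\mathbb{C}))$ has exactly two irreducible components, which in these coordinates are as follows. - The component corresponding to reducible representations, that is, the set of characters of reducible representations: $\{(x_1,x_2,y_0)\in\mathbb{C}^3 \mid x_1=2,\ x_2=2\}$. - The component corresponding to irreducible representations, that is, the Zariski closure of the set of characters of irreducible representations: $\{(x_1,x_2,y_0)\in\mathbb{C}^3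 \mid (x_1-1)(x_2-1)=1,\ y_0^2=x_1+x_2+1\}$. The two components intersect in exactly the two points $x_1=x_2=2$, $y_0=\pm\sqrt5$, and the intersection is transversal at both points: each of the two curves is nonsingular there, and their tangent lines are distinct. -/

import Mathlib

open scoped MatrixGroups

/-- The points of the `SL(r,ℂ)`-variety of characters of a group `G`: the functions `G → ℂ` that are
characters (traces) of representations `G → SL(r,ℂ)`. -/
def CharacterVariety (r : ℕ) (G : Type*) [Group G] : Type _ :=
  {χ : G → ℂ // ∃ ρ : G →* SL(r, ℂ), ∀ γ, χ γ = (ρ γ : Matrix (Fin r) (Fin r) ℂ).trace}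

namespace CharacterVariety

/-- The character `γ ↦ tr (ρ γ)` of a representation `ρ`. -/
def ofHom {r : ℕ} {G : Type*} [Group G] (ρ : G →* SL(r, ℂ)) : CharacterVariety r G :=
  ⟨fun γ => (ρ γ : Matrix (Fin r) (Fin r) ℂ).trace, ρ, fun _ => rfl⟩

/-- The trace function of `γ`: it sends the character `χ` to `χ(γ)`. -/
def traceFun (r : ℕ) {G : Type*} [Group G] (γ : G) : CharacterVariety r G → ℂ :=
  fun χ => χ.1 γ

/-- The coordinate ring of the variety of characters, as an algebra of functions on its points:
it is generated by the trace functions. -/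
def regularFunctions (r : ℕ) (G : Type*) [Group G] : Subalgebra ℂ (CharacterVariety r G → ℂ) :=
  Algebra.adjoin ℂ (Set.range (traceFun r (G := G)))

/-- The Zariski topology: the sets `{f ≠ 0}`, for `f` in the coordinate ring, form a base. -/
instance zariskiTopology (r : ℕ) (G : Type*) [Group G] :
    TopologicalSpace (CharacterVariety r G) :=
  TopologicalSpace.generateFrom {U | ∃ f ∈ regularFunctions r G, U = {χ | f χ ≠ 0}}

/-- The Zariski tangent space at the point `p` of an algebraic subset `Z` of the variety of
characters: the derivations at `p` of the coordinate ring which vanish on the ideal of `Z`. -/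
def tangentSpace {r : ℕ} {G : Type*} [Group G] (Z : Set (CharacterVariety r G))
    (p : CharacterVariety r G) : Submodule ℂ (Module.Dual ℂ (regularFunctions r G)) where
  carrier := {D | (∀ f g : regularFunctions r G, D (f * g) = f.1 p * D g + g.1 p * D f) ∧
    ∀ f : regularFunctions r G, (∀ q ∈ Z, f.1 q = 0) → D f = 0}
  zero_mem' := by simp
  add_mem' := by
    rintro D E ⟨hD, hD'⟩ ⟨hE, hE'⟩
    refine ⟨fun f g => ?_, fun f hf => ?_⟩
    · simp only [LinearMap.add_apply, hD, hE]; ring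
    · simp [hD' f hf, hE' f hf]
  smul_mem' := by
    rintro c D ⟨hD, hD'⟩
    refine ⟨fun f g => ?_, fun f hf => ?_⟩
    · simp only [LinearMap.smul_apply, hD, smul_eq_mul]; ring
    · simp [hD' f hf]

/-- Two algebraic curves `Y` and `Z` meet transversally at the common point `p`: `p` is a
nonsingular point of each of them (the tangent spaces are lines), and the two tangent lines are
distinct. -/
def CurvesMeetTransversallyAt {r : ℕ} {G : Type*} [Group G] (Y Z : Set (CharacterVariety r G))
    (p : CharacterVariety r G) : Prop :=
  p ∈ Y ∧ p ∈ Z ∧ Module.finrank ℂ (tangentSpace Y p) = 1 ∧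
    Module.finrank ℂ (tangentSpace Z p) = 1 ∧ tangentSpace Y p ≠ tangentSpace Z p

/-- A homomorphism to `SL(r,ℂ)` as a linear representation on `ℂ^r`. -/
noncomputable def toRep {r : ℕ} {G : Type*} [Group G] (ρ : G →* SL(r, ℂ)) :
    Representation ℂ G (Fin r → ℂ) where
  toFun γ := Matrix.toLin' (ρ γ : Matrix (Fin r) (Fin r) ℂ)
  map_one' := by simp [Module.End.one_eq_id]
  map_mul' γ δ := by simp [Matrix.toLin'_mul, Module.End.mul_eq_comp]

/-- The set of characters of reducible representations. -/
def reducibleCharacters (r : ℕ) (G : Type*) [Group G] : Set (CharacterVariety r G) :=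
  {χ | ∃ ρ : G →* SL(r, ℂ), ¬ (toRep ρ).IsIrreducible ∧ χ = ofHom ρ}

/-- The set of characters of irreducible representations. -/
def irreducibleCharacters (r : ℕ) (G : Type*) [Group G] : Set (CharacterVariety r G) :=
  {χ | ∃ ρ : G →* SL(r, ℂ), (toRep ρ).IsIrreducible ∧ χ = ofHom ρ}

end CharacterVariety

namespace FigureEight

/-- The generators of the fibred presentation of the figure eight knot group. -/
inductive Gen
  | a
  | b
  | t

/-- The relations `t a t⁻¹ = a b` and `t b t⁻¹ = b a b`. -/
def rels : Set (FreeGroup Gen) :=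
  let a := FreeGroup.of Gen.a
  let b := FreeGroup.of Gen.b
  let t := FreeGroup.of Gen.t
  {t * a * t⁻¹ * (a * b)⁻¹, t * b * t⁻¹ * (b * a * b)⁻¹}

/-- The figure eight knot group `⟨a, b, t ∣ t a t⁻¹ = a b, t b t⁻¹ = b a b⟩`. -/
abbrev Γ : Type := PresentedGroup rels

/-- The variety of characters `X(Γ, SL(2,ℂ))` of the figure eight knot group. -/
abbrev X : Type := CharacterVariety 2 Γ

/-- The coordinate `x₁(χ) = χ(a)`. -/
def x₁ : X → ℂ := CharacterVariety.traceFun 2 (PresentedGroup.of Gen.a : Γ)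

/-- The coordinate `x₂(χ) = χ(b)`. -/
def x₂ : X → ℂ := CharacterVariety.traceFun 2 (PresentedGroup.of Gen.b : Γ)

/-- The coordinate `y₀(χ) = χ(t)`. -/
def y₀ : X → ℂ := CharacterVariety.traceFun 2 (PresentedGroup.of Gen.t : Γ)

/-- The map `χ ↦ (x₁(χ), x₂(χ), y₀(χ))` to affine 3-space. -/
def coords (χ : X) : ℂ × ℂ × ℂ := (x₁ χ, x₂ χ, y₀ χ)

end FigureEight

/-! Write x, z, y for the traces of the images A, B, T of a, b, t. Conjugation in Γ gives tr AB = x,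
tr BAB = z and tr AT = tr BT = tr ABT = y (`trace_AB`, `trace_BAB`, `trace_AT`, `trace_BT`,
`trace_ABT`). Cayley–Hamilton turns the first two into (x - 1)(z - 1) = 1, and Fricke's quadratic
relation for tr ABT then factors as (4 - (x + z))(y² - (x + z + 1)) = 0. This is the decomposition
into two curves (`trace_alternative`); the first factor forces x = z = 2, which is exactly
reducibility (`trace_eq_two_of_eigenvector`, `exists_eigenvector`).

Every element of Γ maps into the span of 1, A, B, AB, T, AT, BT, ABT over the algebra generated by
x, z, y, and these eight traces lie in that algebra, so x, z, y generate the coordinate ring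
(`coordAlgebra_eq`). Explicit matrices realise all points of both curves
(`exists_coords_eq_of_reducible`, `exists_coords_eq_of_curve`).

The line carries only polynomials in y. The other curve is a double cover of the punctured u-line, u
= x - 1, given by y² = u + u⁻¹ + 3; it is irreducible because a norm from this extension vanishes
only trivially, by parity of degree (`eq_zero_of_norm_eq_zero`). Tangent vectors come from
differentiating along parametrised paths, and differentiating the equations bounds the dimension
above. At the common points the tangent directions are (0, 0, 1) and (1, -1, 0). -/

namespace Matrix

/-! ### Trace identities for 2 × 2 matrices -/

variable {R : Type*} [CommRing R]

theorem fin_two_sq (A : Matrix (Fin 2) (Fin 2) R) : A * A = A.trace • A - A.det • 1 := by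
  ext i j
  fin_cases i <;> fin_cases j <;>
    simp [mul_apply, trace_fin_two, det_fin_two, Fin.sum_univ_two] <;> ring

/-- The polarisation of Cayley–Hamilton. -/
theorem fin_two_mul_add_mul (A B : Matrix (Fin 2) (Fin 2) R) :
    A * B + B * A = A.trace • B + B.trace • A + ((A * B).trace - A.trace * B.trace) • 1 := by
  ext i j
  fin_cases i <;> fin_cases j <;>
    simp [mul_apply, trace_fin_two, Fin.sum_univ_two] <;> ring

theorem fin_two_trace_mul_mul (A B : Matrix (Fin 2) (Fin 2) R) :
    (B * A * B).trace = B.trace * (A * B).trace - B.det * A.trace := by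
  simp [mul_apply, trace_fin_two, det_fin_two, Fin.sum_univ_two]
  ring

/-- The quadratic equation satisfied by the trace of a product of three matrices, whose other root
is the trace of the product in the opposite cyclic order. -/
theorem fin_two_fricke (A B C : Matrix (Fin 2) (Fin 2) R) (hA : A.det = 1) (hB : B.det = 1)
    (hC : C.det = 1) :
    (A * B * C).trace ^ 2 -
        (A.trace * (B * C).trace + B.trace * (A * C).trace + C.trace * (A * B).trace -
          A.trace * B.trace * C.trace) * (A * B * C).trace +
        (A.trace ^ 2 + B.trace ^ 2 + C.trace ^ 2 + (A * B).trace ^ 2 + (A * C).trace ^ 2 +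
          (B * C).trace ^ 2 - A.trace * B.trace * (A * B).trace -
          A.trace * C.trace * (A * C).trace - B.trace * C.trace * (B * C).trace +
          (A * B).trace * (B * C).trace * (A * C).trace - 4) = 0 := by
  -- Homogenised with determinants, the relation becomes a polynomial identity in the twelve
  -- entries, free of side conditions.
  have h : (A * B * C).trace ^ 2 -
        (A.trace * (B * C).trace + B.trace * (A * C).trace + C.trace * (A * B).trace -
          A.trace * B.trace * C.trace) * (A * B * C).trace +
        (A.trace ^ 2 * (B.det * C.det) + B.trace ^ 2 * (A.det * C.det) +
          C.trace ^ 2 * (A.det * B.det) + (A * B).trace ^ 2 * C.det + (A * C).trace ^ 2 * B.det +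
          (B * C).trace ^ 2 * A.det - A.trace * B.trace * (A * B).trace * C.det -
          A.trace * C.trace * (A * C).trace * B.det - B.trace * C.trace * (B * C).trace * A.det +
          (A * B).trace * (B * C).trace * (A * C).trace - 4 * (A.det * B.det * C.det)) = 0 := by
    simp only [mul_apply, trace_fin_two, det_fin_two, Fin.sum_univ_two]
    ring
  simpa [hA, hB, hC] using h

/-- Two unipotent matrices whose product is unipotent have a common fixed vector. -/
theorem exists_common_fixed_vector {K : Type*} [Field K] {A B : Matrix (Fin 2) (Fin 2) K}
    (hA : A.det = 1) (hB : B.det = 1) (hA' : A.trace = 2) (hB' : B.trace = 2)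
    (hAB : (A * B).trace = 2) : ∃ v ≠ 0, A *ᵥ v = v ∧ B *ᵥ v = v := by
  simp only [mul_apply, trace_fin_two, det_fin_two, Fin.sum_univ_two] at hA hB hA' hB' hAB
  obtain ⟨p, hp⟩ : ∃ p, p = A 0 0 - 1 := ⟨_, rfl⟩
  obtain ⟨x, hx⟩ : ∃ x, x = B 0 0 - 1 := ⟨_, rfl⟩
  have hA0 : A 0 0 = 1 + p := by linear_combination -hp
  have hA1 : A 1 1 = 1 - p := by linear_combination hA' + hp
  have hB0 : B 0 0 = 1 + x := by linear_combination -hx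
  have hB1 : B 1 1 = 1 - x := by linear_combination hB' + hx
  rw [hA0, hA1] at hA
  rw [hB0, hB1] at hB
  rw [hA0, hA1, hB0, hB1] at hAB
  generalize hq : A 0 1 = q at *
  generalize hr : A 1 0 = r at *
  generalize hy : B 0 1 = y at *
  generalize hz : B 1 0 = z at *
  -- With A = 1 + N and B = 1 + M, `hA` and `hB` say that N and M are nilpotent, and `hAB` that tr
  -- NM = 0. This makes N and M proportional: the minors `h1`, `h2` and the diagonal entries `h3`,
  -- `h4` of NM vanish.
  have h1 : r * x = p * z := by
    refine sub_eq_zero.1 (pow_eq_zero_iff two_ne_zero |>.1 ?_)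
    linear_combination -r ^ 2 * hB - z ^ 2 * hA - r * z * hAB
  have h2 : q * x = p * y := by
    refine sub_eq_zero.1 (pow_eq_zero_iff two_ne_zero |>.1 ?_)
    linear_combination -q ^ 2 * hB - y ^ 2 * hA - q * y * hAB
  have h3 : p * x + q * z = 0 := by
    refine pow_eq_zero_iff two_ne_zero |>.1 ?_
    linear_combination q * z * hAB + y * z * hA - p ^ 2 * hB
  have h4 : p * x + r * y = 0 := by linear_combination hAB - h3
  have key : ∀ v : Fin 2 → K, p * v 0 + q * v 1 = 0 → r * v 0 = p * v 1 →
      x * v 0 + y * v 1 = 0 → z * v 0 = x * v 1 → A *ᵥ v = v ∧ B *ᵥ v = v := by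
    intro v e1 e2 e3 e4
    constructor <;> ext i <;> fin_cases i <;>
      simp [mulVec, dotProduct, Fin.sum_univ_two, hA0, hA1, hB0, hB1, hq, hr, hy, hz]
    · linear_combination e1
    · linear_combination e2
    · linear_combination e3
    · linear_combination e4
  -- The candidates are the columns of N and M: the image of a nonzero nilpotent is its own kernel
  -- and is killed by the other matrix as well. If all columns vanish, then A = B = 1.
  by_cases c1 : (![q, -p] : Fin 2 → K) = 0
  · by_cases c2 : (![p, r] : Fin 2 → K) = 0
    · by_cases c3 : (![y, -x] : Fin 2 → K) = 0
      · by_cases c4 : (![x, z] : Fin 2 → K) = 0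
        · have e1 : p = 0 := congrFun c2 0
          have e2 : r = 0 := congrFun c2 1
          have e3 : x = 0 := congrFun c4 0
          have e4 : z = 0 := congrFun c4 1
          refine ⟨![1, 0], fun h => one_ne_zero (congrFun h 0), key _ ?_ ?_ ?_ ?_⟩ <;>
            simp [e1, e2, e3, e4]
        · refine ⟨_, c4, key _ ?_ ?_ ?_ ?_⟩ <;> simp
          · linear_combination h3
          · linear_combination h1
          · linear_combination -hB
          · ring
      · refine ⟨_, c3, key _ ?_ ?_ ?_ ?_⟩ <;> simp
        · linear_combination -h2
        · linear_combination h4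
        · ring
        · linear_combination -hB
    · refine ⟨_, c2, key _ ?_ ?_ ?_ ?_⟩ <;> simp
      · linear_combination -hA
      · ring
      · linear_combination h4
      · linear_combination -h1
  · refine ⟨_, c1, key _ ?_ ?_ ?_ ?_⟩ <;> simp
    · ring
    · linear_combination -hA
    · linear_combination h2
    · linear_combination h3

end Matrix

/-! ### Reducibility as existence of a common eigenvector -/

namespace CharacterVariety

open Matrix

variable {G : Type*} [Group G]

/-- The image of an element under a representation, as a matrix. -/
def mat (ρ : G →* SL(2, ℂ)) (γ : G) : Matrix (Fin 2) (Fin 2) ℂ := (ρ γ).1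

theorem mat_one (ρ : G →* SL(2, ℂ)) : mat ρ 1 = 1 := by
  rw [mat, map_one]
  rfl

theorem mat_mul (ρ : G →* SL(2, ℂ)) (γ δ : G) : mat ρ (γ * δ) = mat ρ γ * mat ρ δ := by
  rw [mat, map_mul]
  rfl

theorem mat_inv_mul (ρ : G →* SL(2, ℂ)) (γ : G) : mat ρ γ⁻¹ * mat ρ γ = 1 := by
  rw [← mat_mul, inv_mul_cancel, mat_one]

theorem det_mat (ρ : G →* SL(2, ℂ)) (γ : G) : (mat ρ γ).det = 1 := (ρ γ).2

theorem trace_mat_conj (ρ : G →* SL(2, ℂ)) (γ δ : G) :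
    (mat ρ (γ * δ * γ⁻¹)).trace = (mat ρ δ).trace := by
  rw [mat_mul, trace_mul_comm, ← mat_mul, inv_mul_cancel_left]

theorem toRep_apply (ρ : G →* SL(2, ℂ)) (γ : G) (v : Fin 2 → ℂ) : toRep ρ γ v = mat ρ γ *ᵥ v :=
  Matrix.toLin'_apply _ _

/-- A representation in `SL(2,ℂ)` is reducible iff it has a common eigenvector. -/
theorem not_isIrreducible_iff (ρ : G →* SL(2, ℂ)) :
    ¬ (toRep ρ).IsIrreducible ↔
      ∃ v ≠ 0, ∀ γ, ∃ c : ℂ, mat ρ γ *ᵥ v = c • v := by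
  constructor
  · intro h
    have : ∃ W : Subrepresentation (toRep ρ), W.toSubmodule ≠ ⊥ ∧ W.toSubmodule ≠ ⊤ := by
      by_contra! hW
      have : Nontrivial (Subrepresentation (toRep ρ)) := ⟨⊥, ⊤, fun e => ?_⟩
      · refine h ⟨fun W => ?_⟩
        by_cases e : W.toSubmodule = ⊥
        · exact Or.inl (Subrepresentation.toSubmodule_injective e)
        · exact Or.inr (Subrepresentation.toSubmodule_injective (hW W e))
      · exact bot_ne_top (α := Submodule ℂ (Fin 2 → ℂ))
          (congrArg Subrepresentation.toSubmodule e)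
    obtain ⟨W, h1, h2⟩ := this
    have hlt := Submodule.finrank_lt h2
    rw [Module.finrank_fin_fun] at hlt
    have hpos : Module.finrank ℂ W.toSubmodule ≠ 0 := fun e => h1 (Submodule.finrank_eq_zero.1 e)
    obtain ⟨v, hv, hW⟩ := finrank_eq_one_iff'.1 (show Module.finrank ℂ W.toSubmodule = 1 by omega)
    refine ⟨v, fun e => hv (Subtype.ext e), fun γ => ?_⟩
    obtain ⟨c, hc⟩ := hW ⟨_, W.apply_mem_toSubmodule γ v.2⟩
    exact ⟨c, by rw [← toRep_apply]; exact (congrArg Subtype.val hc).symm⟩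
  · rintro ⟨v, hv, hρ⟩ h
    let W : Subrepresentation (toRep ρ) :=
      { toSubmodule := Submodule.span ℂ {v}
        apply_mem_toSubmodule := by
          intro γ w hw
          obtain ⟨d, rfl⟩ := Submodule.mem_span_singleton.1 hw
          obtain ⟨c, hc⟩ := hρ γ
          rw [toRep_apply, mulVec_smul, hc]
          exact Submodule.smul_mem _ _
            (Submodule.smul_mem _ _ (Submodule.mem_span_singleton_self v)) }
    rcases h.eq_bot_or_eq_top W with e | e
    · have := congrArg Subrepresentation.toSubmodule e
      exact hv (Submodule.span_singleton_eq_bot.1 this)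
    · have e' : Submodule.span ℂ {v} = ⊤ := congrArg Subrepresentation.toSubmodule e
      have h1 := finrank_span_singleton (K := ℂ) hv
      rw [e', finrank_top, Module.finrank_fin_fun] at h1
      omega

/-- The stabilizer of the line spanned by a vector. -/
def lineStabilizer (ρ : G →* SL(2, ℂ)) (v : Fin 2 → ℂ) : Subgroup G where
  carrier := {γ | ∃ c : ℂ, mat ρ γ *ᵥ v = c • v}
  one_mem' := ⟨1, by rw [mat_one, one_mulVec, one_smul]⟩
  mul_mem' := by
    rintro γ δ ⟨c, hc⟩ ⟨d, hd⟩
    refine ⟨d * c, ?_⟩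
    rw [mat_mul, ← mulVec_mulVec, hd, mulVec_smul, hc, smul_smul]
  inv_mem' := by
    rintro γ ⟨c, hc⟩
    have h : v = c • (mat ρ γ⁻¹ *ᵥ v) := by
      rw [← mulVec_smul, ← hc, mulVec_mulVec, mat_inv_mul, one_mulVec]
    by_cases h0 : c = 0
    · rw [h0, zero_smul] at h
      exact ⟨0, by simp [h]⟩
    · exact ⟨c⁻¹, by nth_rw 2 [h]; rw [smul_smul, inv_mul_cancel₀ h0, one_smul]⟩

end CharacterVariety

/-! ### Trace relations in the figure eight knot group -/

namespace FigureEight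

open Matrix CharacterVariety

/-- The generator `a` of the figure eight knot group. -/
abbrev genA : Γ := PresentedGroup.of Gen.a

/-- The generator `b` of the figure eight knot group. -/
abbrev genB : Γ := PresentedGroup.of Gen.b

/-- The generator `t` of the figure eight knot group. -/
abbrev genT : Γ := PresentedGroup.of Gen.t

theorem genT_mul_genA : genT * genA = genA * genB * genT := by
  have h : (PresentedGroup.mk rels _ : Γ) = 1 :=
    PresentedGroup.one_of_mem (rels := rels) (Set.mem_insert _ _)
  simp only [map_mul, map_inv] at h
  exact mul_inv_eq_iff_eq_mul.1 (mul_inv_eq_one.1 h)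

theorem genT_mul_genB : genT * genB = genB * genA * genB * genT := by
  have h : (PresentedGroup.mk rels _ : Γ) = 1 :=
    PresentedGroup.one_of_mem (rels := rels) (Set.mem_insert_of_mem _ rfl)
  simp only [map_mul, map_inv] at h
  exact mul_inv_eq_iff_eq_mul.1 (mul_inv_eq_one.1 h)

theorem eq_top_of_gen_mem (H : Subgroup Γ) (ha : genA ∈ H) (hb : genB ∈ H) (ht : genT ∈ H) :
    H = ⊤ := by
  rw [eq_top_iff, ← PresentedGroup.closure_range_of, Subgroup.closure_le]
  rintro _ ⟨g, rfl⟩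
  cases g <;> assumption

section Representation

variable (ρ : Γ →* SL(2, ℂ))

theorem mat_T_mul_A : mat ρ genT * mat ρ genA = mat ρ genA * mat ρ genB * mat ρ genT := by
  simp only [← mat_mul, genT_mul_genA]

theorem mat_T_mul_B :
    mat ρ genT * mat ρ genB = mat ρ genB * mat ρ genA * mat ρ genB * mat ρ genT := by
  simp only [← mat_mul, genT_mul_genB]

theorem trace_AB : (mat ρ genA * mat ρ genB).trace = (mat ρ genA).trace := by
  rw [← mat_mul, ← trace_mat_conj ρ genT genA, genT_mul_genA, mul_inv_cancel_right]

theorem trace_BAB : (mat ρ genB * mat ρ genA * mat ρ genB).trace = (mat ρ genB).trace := by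
  rw [← mat_mul, ← mat_mul, ← trace_mat_conj ρ genT genB, genT_mul_genB, mul_inv_cancel_right]

/-- The second relation reads b⁻¹tb = abt. In the same way the first one, as a⁻¹ta = bt, gives
`trace_BT`. -/
theorem trace_ABT : (mat ρ genA * mat ρ genB * mat ρ genT).trace = (mat ρ genT).trace := by
  rw [← mat_mul, ← mat_mul, ← trace_mat_conj ρ genB⁻¹ genT]
  congr 2
  rw [inv_inv, mul_assoc genB⁻¹, genT_mul_genB]
  group

theorem trace_AT : (mat ρ genA * mat ρ genT).trace = (mat ρ genT).trace := by
  rw [trace_mul_comm, mat_T_mul_A, trace_ABT]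

theorem trace_BT : (mat ρ genB * mat ρ genT).trace = (mat ρ genT).trace := by
  rw [← mat_mul, ← trace_mat_conj ρ genA⁻¹ genT]
  congr 2
  rw [inv_inv, mul_assoc genA⁻¹, genT_mul_genA]
  group

theorem traceA_mul_traceB :
    (mat ρ genA).trace * (mat ρ genB).trace = (mat ρ genA).trace + (mat ρ genB).trace := by
  have h := fin_two_trace_mul_mul (mat ρ genA) (mat ρ genB)
  rw [trace_BAB, trace_AB, det_mat] at h
  linear_combination -h

theorem trace_alternative :
    ((mat ρ genA).trace = 2 ∧ (mat ρ genB).trace = 2) ∨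
      (mat ρ genT).trace ^ 2 = (mat ρ genA).trace + (mat ρ genB).trace + 1 := by
  have h := fin_two_fricke (mat ρ genA) (mat ρ genB) (mat ρ genT) (det_mat ρ _) (det_mat ρ _)
    (det_mat ρ _)
  have hp := traceA_mul_traceB ρ
  rw [trace_ABT, trace_AB, trace_AT, trace_BT] at h
  generalize (mat ρ genA).trace = x at *
  generalize (mat ρ genB).trace = z at *
  generalize (mat ρ genT).trace = y at *
  have h' : (4 - (x + z)) * (y ^ 2 - (x + z + 1)) = 0 := by
    linear_combination h + (x - y ^ 2 + 3) * hp
  rcases mul_eq_zero.1 h' with h4 | h4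
  · left
    -- Sum and product of x and z are both 4, so (x - z)² = 0.
    have : x - z = 0 := pow_eq_zero_iff two_ne_zero |>.1
      (by linear_combination -(x + z) * h4 - 4 * hp)
    constructor
    · linear_combination this / 2 - h4 / 2
    · linear_combination -this / 2 - h4 / 2
  · right
    linear_combination h4

/-- The eigenvalues on the common eigenvector commute, so the relations force those of a and b to be
1. A matrix of determinant 1 with eigenvalue 1 has trace 2. -/
theorem trace_eq_two_of_eigenvector {v : Fin 2 → ℂ} (hv : v ≠ 0)
    (h : ∀ γ, ∃ c : ℂ, mat ρ γ *ᵥ v = c • v) :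
    (mat ρ genA).trace = 2 ∧ (mat ρ genB).trace = 2 := by
  obtain ⟨α, hα⟩ := h genA
  obtain ⟨β, hβ⟩ := h genB
  obtain ⟨τ, hτ⟩ := h genT
  have hne : ∀ (γ : Γ) (c : ℂ), mat ρ γ *ᵥ v = c • v → c ≠ 0 := by
    rintro γ c hc rfl
    rw [zero_smul] at hc
    rw [← one_mulVec v, ← mat_inv_mul ρ γ, ← mulVec_mulVec, hc, mulVec_zero] at hv
    exact hv rfl
  have hα0 := hne _ _ hα
  have hβ0 := hne _ _ hβ
  have hτ0 := hne _ _ hτ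
  have e1 := congrArg (· *ᵥ v) (mat_T_mul_A ρ)
  have e2 := congrArg (· *ᵥ v) (mat_T_mul_B ρ)
  simp only [← mulVec_mulVec, hα, hβ, hτ, mulVec_smul, smul_smul] at e1 e2
  have e1 := smul_left_injective ℂ hv e1
  have e2 := smul_left_injective ℂ hv e2
  have hβ1 : β = 1 := by
    have : α * τ * (β - 1) = 0 := by linear_combination -e1
    rcases mul_eq_zero.1 this with h | h
    · exact absurd h (mul_ne_zero hα0 hτ0)
    · linear_combination h
  have hα1 : α = 1 := by
    rw [hβ1] at e2
    have : τ * (α - 1) = 0 := by linear_combination -e2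
    rcases mul_eq_zero.1 this with h | h
    · exact absurd h hτ0
    · linear_combination h
  have key : ∀ M : Matrix (Fin 2) (Fin 2) ℂ, M.det = 1 → M *ᵥ v = v → M.trace = 2 := by
    intro M hM hMv
    have h1 := congrArg (· *ᵥ v) (fin_two_sq M)
    simp only [← mulVec_mulVec, hMv, sub_mulVec, smul_mulVec, one_mulVec, hM, ← sub_smul] at h1
    have := smul_left_injective ℂ hv ((one_smul ℂ v).trans h1)
    linear_combination -this
  rw [hα1, one_smul] at hα
  rw [hβ1, one_smul] at hβ
  exact ⟨key _ (det_mat ρ _) hα, key _ (det_mat ρ _) hβ⟩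

/-- The common fixed space of A and B is nonzero since A, B and AB all have trace 2. It is stable
under T⁻¹, because the relations move a and b past t⁻¹ at the cost of words in a and b only. An
eigenvector of T⁻¹ inside it is common to all three generators. -/
theorem exists_eigenvector (hA : (mat ρ genA).trace = 2) (hB : (mat ρ genB).trace = 2) :
    ∃ v ≠ 0, ∀ γ, ∃ c : ℂ, mat ρ γ *ᵥ v = c • v := by
  suffices h : ∃ v ≠ 0, mat ρ genA *ᵥ v = v ∧ mat ρ genB *ᵥ v = v ∧
      ∃ c : ℂ, mat ρ genT *ᵥ v = c • v by
    obtain ⟨v, hv, ha, hb, ht⟩ := h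
    have := eq_top_of_gen_mem (lineStabilizer ρ v) ⟨1, by simpa using ha⟩ ⟨1, by simpa using hb⟩ ht
    exact ⟨v, hv, fun γ => (this ▸ Subgroup.mem_top γ : γ ∈ lineStabilizer ρ v)⟩
  obtain ⟨v, hv, ha, hb⟩ := exists_common_fixed_vector (det_mat ρ genA) (det_mat ρ genB) hA hB
    ((trace_AB ρ).trans hA)
  let W : Submodule ℂ (Fin 2 → ℂ) :=
    { carrier := {w | mat ρ genA *ᵥ w = w ∧ mat ρ genB *ᵥ w = w}
      zero_mem' := by simp
      add_mem' := by
        rintro w w' ⟨h1, h2⟩ ⟨h3, h4⟩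
        exact ⟨by rw [mulVec_add, h1, h3], by rw [mulVec_add, h2, h4]⟩
      smul_mem' := by
        rintro c w ⟨h1, h2⟩
        exact ⟨by rw [mulVec_smul, h1], by rw [mulVec_smul, h2]⟩ }
  have hWinv : ∀ w ∈ W, mat ρ genT⁻¹ *ᵥ w ∈ W := by
    rintro w ⟨h1, h2⟩
    constructor
    · rw [mulVec_mulVec, ← mat_mul, show genA * genT⁻¹ = genT⁻¹ * (genA * genB) by
        rw [eq_inv_mul_iff_mul_eq, ← mul_assoc, genT_mul_genA, mul_inv_cancel_right]]
      simp only [mat_mul, ← mulVec_mulVec, h1, h2]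
    · rw [mulVec_mulVec, ← mat_mul, show genB * genT⁻¹ = genT⁻¹ * (genB * genA * genB) by
        rw [eq_inv_mul_iff_mul_eq, ← mul_assoc, genT_mul_genB, mul_inv_cancel_right]]
      simp only [mat_mul, ← mulVec_mulVec, h1, h2]
  have : Nontrivial W := ⟨⟨v, ha, hb⟩, 0, fun e => hv (congrArg Subtype.val e)⟩
  obtain ⟨c, hc⟩ := Module.End.exists_eigenvalue
    ((Matrix.toLin' (mat ρ genT⁻¹)).restrict (p := W) (q := W)
      (fun w hw => by rw [toLin'_apply]; exact hWinv w hw))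
  obtain ⟨w, hw⟩ := hc.exists_hasEigenvector
  have h := congrArg Subtype.val hw.apply_eq_smul
  rw [LinearMap.coe_restrict_apply, toLin'_apply] at h
  refine ⟨w, fun e => hw.2 (Subtype.ext e), w.2.1, w.2.2, ?_⟩
  have := (lineStabilizer ρ w).inv_mem ⟨c, h⟩
  rwa [inv_inv] at this

end Representation

end FigureEight

/-! ### The coordinate ring is generated by x₁, x₂, y₀ -/

/-- If `B * A` is a combination of `1, A, B, A * B` and `A, B` satisfy quadratic equations, then the
span of `1, A, B, A * B` is closed under left multiplication by `A` and `B`. -/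
theorem mul_mem_span_of_quadratic {R E : Type*} [CommRing R] [Ring E] [Algebra R E] {A B : E}
    {x z c : R} (hA : A * A = x • A - 1) (hB : B * B = z • B - 1)
    (hBA : A * B + B * A = x • B + z • A + c • (1 : E)) {n : E}
    (hn : n ∈ Submodule.span R {1, A, B, A * B}) :
    A * n ∈ Submodule.span R {1, A, B, A * B} ∧ B * n ∈ Submodule.span R {1, A, B, A * B} := by
  have h1 : (1 : E) ∈ Submodule.span R {1, A, B, A * B} := Submodule.subset_span (by simp)
  have h2 : A ∈ Submodule.span R {1, A, B, A * B} := Submodule.subset_span (by simp)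
  have h3 : B ∈ Submodule.span R {1, A, B, A * B} := Submodule.subset_span (by simp)
  have h4 : A * B ∈ Submodule.span R {1, A, B, A * B} := Submodule.subset_span (by simp)
  have hBA : B * A = x • B + z • A + c • (1 : E) - A * B := eq_sub_of_add_eq' hBA
  have hBAmem : B * A ∈ Submodule.span R {1, A, B, A * B} := by
    rw [hBA]
    exact sub_mem (add_mem (add_mem (Submodule.smul_mem _ _ h3) (Submodule.smul_mem _ _ h2))
      (Submodule.smul_mem _ _ h1)) h4
  have hBBmem : B * B ∈ Submodule.span R {1, A, B, A * B} := by
    rw [hB]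
    exact sub_mem (Submodule.smul_mem _ _ h3) h1
  induction hn using Submodule.span_induction with
  | mem e he =>
    rcases he with rfl | rfl | rfl | rfl
    · simpa using ⟨h2, h3⟩
    · refine ⟨?_, hBAmem⟩
      rw [hA]
      exact sub_mem (Submodule.smul_mem _ _ h2) h1
    · exact ⟨h4, hBBmem⟩
    · constructor
      · rw [← mul_assoc, hA, sub_mul, smul_mul_assoc, one_mul]
        exact sub_mem (Submodule.smul_mem _ _ h4) h3
      · rw [← mul_assoc, hBA, sub_mul, add_mul, add_mul, smul_mul_assoc, smul_mul_assoc,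
          smul_mul_assoc, one_mul, mul_assoc A B B, hB, mul_sub, mul_smul_comm, mul_one, ← hB]
        exact sub_mem (add_mem (add_mem (Submodule.smul_mem _ _ hBBmem) (Submodule.smul_mem _ _ h4))
          (Submodule.smul_mem _ _ h3)) (sub_mem (Submodule.smul_mem _ _ h4) h2)
  | zero => simp
  | add u v _ _ hu hv =>
    rw [mul_add, mul_add]
    exact ⟨add_mem hu.1 hv.1, add_mem hu.2 hv.2⟩
  | smul r u _ hu =>
    rw [mul_smul_comm, mul_smul_comm]
    exact ⟨Submodule.smul_mem _ _ hu.1, Submodule.smul_mem _ _ hu.2⟩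

namespace FigureEight

open Matrix CharacterVariety

/-- A representation with a given character. -/
noncomputable def rep (χ : X) : Γ →* SL(2, ℂ) := χ.2.choose

theorem apply_eq_trace (χ : X) (γ : Γ) : χ.1 γ = (mat (rep χ) γ).trace := χ.2.choose_spec γ

theorem eq_ofHom_rep (χ : X) : χ = ofHom (rep χ) := Subtype.ext (funext (apply_eq_trace χ))

/-- The tautological representation, with entries in the functions on the variety of characters. -/
noncomputable def univMat (γ : Γ) : Matrix (Fin 2) (Fin 2) (X → ℂ) :=
  fun i j χ => mat (rep χ) γ i j

theorem univMat_one : univMat 1 = 1 := by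
  ext i j χ
  simp only [univMat, mat_one, one_apply]
  split <;> rfl

theorem univMat_mul (γ δ : Γ) : univMat (γ * δ) = univMat γ * univMat δ := by
  ext i j χ
  simp [univMat, mat_mul, mul_apply]

theorem trace_univMat (γ : Γ) : (univMat γ).trace = traceFun 2 γ := by
  ext χ
  simp [univMat, traceFun, apply_eq_trace, trace_fin_two]

theorem det_univMat (γ : Γ) : (univMat γ).det = 1 := by
  ext χ
  have := det_mat (rep χ) γ
  rw [det_fin_two] at this
  simpa [univMat, det_fin_two] using this

theorem univMat_inv (γ : Γ) : univMat γ⁻¹ = traceFun 2 γ • 1 - univMat γ := by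
  have h := congrArg (univMat γ⁻¹ * ·) (fin_two_sq (univMat γ))
  simp only [mul_sub, mul_smul_comm, ← univMat_mul, inv_mul_cancel, inv_mul_cancel_left,
    univMat_one, det_univMat, trace_univMat, mul_one, one_smul] at h
  rw [h, sub_sub_cancel]

/-- The algebra generated by the coordinates `x₁, x₂, y₀`. -/
noncomputable abbrev coordAlgebra : Subalgebra ℂ (X → ℂ) := Algebra.adjoin ℂ {x₁, x₂, y₀}

theorem x₁_mem : x₁ ∈ coordAlgebra := Algebra.subset_adjoin (by simp)

theorem x₂_mem : x₂ ∈ coordAlgebra := Algebra.subset_adjoin (by simp)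

theorem y₀_mem : y₀ ∈ coordAlgebra := Algebra.subset_adjoin (by simp)

theorem x₁_apply (χ : X) : x₁ χ = (mat (rep χ) genA).trace := apply_eq_trace χ genA

theorem x₂_apply (χ : X) : x₂ χ = (mat (rep χ) genB).trace := apply_eq_trace χ genB

theorem y₀_apply (χ : X) : y₀ χ = (mat (rep χ) genT).trace := apply_eq_trace χ genT

/-- The span of the images of `1, a, b, ab` over the coordinate algebra. -/
noncomputable def fibreSpan : Submodule coordAlgebra (Matrix (Fin 2) (Fin 2) (X → ℂ)) :=
  Submodule.span coordAlgebra {1, univMat genA, univMat genB, univMat genA * univMat genB}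

theorem univMat_AB_trace : (univMat genA * univMat genB).trace = x₁ := by
  ext χ
  rw [← univMat_mul, trace_univMat, x₁_apply, ← trace_AB, ← mat_mul]
  exact apply_eq_trace χ _

theorem univMat_mul_mem_fibreSpan {n : Matrix (Fin 2) (Fin 2) (X → ℂ)} (hn : n ∈ fibreSpan) :
    univMat genA * n ∈ fibreSpan ∧ univMat genB * n ∈ fibreSpan := by
  refine mul_mem_span_of_quadratic (R := coordAlgebra) (x := ⟨x₁, x₁_mem⟩) (z := ⟨x₂, x₂_mem⟩)
    (c := ⟨x₁ - x₁ * x₂, sub_mem x₁_mem (mul_mem x₁_mem x₂_mem)⟩) ?_ ?_ ?_ hn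
  · rw [fin_two_sq, det_univMat, trace_univMat, one_smul]
    rfl
  · rw [fin_two_sq, det_univMat, trace_univMat, one_smul]
    rfl
  · rw [fin_two_mul_add_mul, univMat_AB_trace, trace_univMat, trace_univMat]
    rfl

/-- Conjugation by t sends a, b, ab to words in a and b, whose images stay in `fibreSpan`. -/
theorem univMat_T_mul_mem {n : Matrix (Fin 2) (Fin 2) (X → ℂ)} (hn : n ∈ fibreSpan) :
    ∃ n' ∈ fibreSpan, univMat genT * n = n' * univMat genT := by
  have h1 : 1 ∈ fibreSpan := Submodule.subset_span (by simp)
  have hTA : univMat genT * univMat genA = univMat genA * univMat genB * univMat genT := by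
    simp only [← univMat_mul, genT_mul_genA]
  have hTB : univMat genT * univMat genB =
      univMat genB * univMat genA * univMat genB * univMat genT := by
    simp only [← univMat_mul, genT_mul_genB]
  have hB := (univMat_mul_mem_fibreSpan h1).2
  have hAB := (univMat_mul_mem_fibreSpan hB).1
  have hBAB := (univMat_mul_mem_fibreSpan hAB).2
  have hABBAB := (univMat_mul_mem_fibreSpan (univMat_mul_mem_fibreSpan hBAB).2).1
  rw [mul_one] at hAB hBAB hABBAB
  induction hn using Submodule.span_induction with
  | mem e he =>
    rcases he with rfl | rfl | rfl | rfl
    · exact ⟨1, h1, by simp⟩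
    · exact ⟨_, hAB, hTA⟩
    · exact ⟨_, hBAB, by rw [hTB]; simp only [mul_assoc]⟩
    · refine ⟨_, hABBAB, ?_⟩
      rw [← mul_assoc, hTA, mul_assoc _ (univMat genT), hTB]
      simp only [mul_assoc]
  | zero => exact ⟨0, zero_mem _, by simp⟩
  | add u v _ _ hu hv =>
    obtain ⟨u', hu', eu⟩ := hu
    obtain ⟨v', hv', ev⟩ := hv
    exact ⟨u' + v', add_mem hu' hv', by rw [mul_add, add_mul, eu, ev]⟩
  | smul r u _ hu =>
    obtain ⟨u', hu', eu⟩ := hu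
    exact ⟨r • u', Submodule.smul_mem _ _ hu', by rw [mul_smul_comm, eu, smul_mul_assoc]⟩

/-- The span of the images of `1, a, b, ab, t, at, bt, abt` over the coordinate algebra. -/
noncomputable def totalSpan : Submodule coordAlgebra (Matrix (Fin 2) (Fin 2) (X → ℂ)) :=
  fibreSpan ⊔ fibreSpan.map (LinearMap.mulRight coordAlgebra (univMat genT))

theorem mem_totalSpan {w : Matrix (Fin 2) (Fin 2) (X → ℂ)} :
    w ∈ totalSpan ↔ ∃ n ∈ fibreSpan, ∃ n' ∈ fibreSpan, n + n' * univMat genT = w := by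
  simp [totalSpan, Submodule.mem_sup]

/-- T moves past `fibreSpan`, and a resulting T² is reduced by Cayley–Hamilton to y₀T - 1. -/
theorem univMat_gen_mul_mem {w : Matrix (Fin 2) (Fin 2) (X → ℂ)} (hw : w ∈ totalSpan) :
    univMat genA * w ∈ totalSpan ∧ univMat genB * w ∈ totalSpan ∧
      univMat genT * w ∈ totalSpan := by
  obtain ⟨n, hn, n', hn', rfl⟩ := mem_totalSpan.1 hw
  have h := univMat_mul_mem_fibreSpan hn
  have h' := univMat_mul_mem_fibreSpan hn'
  obtain ⟨k, hk, ek⟩ := univMat_T_mul_mem hn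
  obtain ⟨k', hk', ek'⟩ := univMat_T_mul_mem hn'
  refine ⟨mem_totalSpan.2 ⟨_, h.1, _, h'.1, by rw [mul_add, mul_assoc]⟩,
    mem_totalSpan.2 ⟨_, h.2, _, h'.2, by rw [mul_add, mul_assoc]⟩,
    mem_totalSpan.2 ⟨-k', neg_mem hk', k + (⟨y₀, y₀_mem⟩ : coordAlgebra) • k',
      add_mem hk (Submodule.smul_mem _ _ hk'), ?_⟩⟩
  have hT : univMat genT * univMat genT =
      (⟨y₀, y₀_mem⟩ : coordAlgebra) • univMat genT - 1 := by
    rw [fin_two_sq, det_univMat, trace_univMat, one_smul]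
    rfl
  rw [mul_add, ← mul_assoc, ek, ek', mul_assoc k', hT, mul_sub, mul_smul_comm, add_mul,
    smul_mul_assoc, mul_one]
  abel

/-- The elements whose images preserve `totalSpan`, together with their inverses. -/
def spanStabilizer : Subgroup Γ where
  carrier := {γ | ∀ w ∈ totalSpan, univMat γ * w ∈ totalSpan ∧ univMat γ⁻¹ * w ∈ totalSpan}
  one_mem' w hw := by simpa [univMat_one] using hw
  mul_mem' {γ δ} hγ hδ w hw := by
    rw [_root_.mul_inv_rev, univMat_mul, univMat_mul, mul_assoc, mul_assoc]
    exact ⟨(hγ _ (hδ _ hw).1).1, (hδ _ (hγ _ hw).2).2⟩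
  inv_mem' {γ} hγ w hw := by
    rw [inv_inv]
    exact (hγ w hw).symm

/-- Inverses come for free: by Cayley–Hamilton the inverse matrix is the trace minus the matrix. -/
theorem mem_spanStabilizer {γ : Γ} (hγ : traceFun 2 γ ∈ coordAlgebra)
    (h : ∀ w ∈ totalSpan, univMat γ * w ∈ totalSpan) : γ ∈ spanStabilizer := by
  refine fun w hw => ⟨h w hw, ?_⟩
  rw [univMat_inv, sub_mul, smul_mul_assoc, one_mul]
  exact sub_mem (Submodule.smul_mem totalSpan ⟨_, hγ⟩ hw) (h w hw)

theorem univMat_mem_totalSpan (γ : Γ) : univMat γ ∈ totalSpan := by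
  have h := eq_top_of_gen_mem spanStabilizer
    (mem_spanStabilizer x₁_mem fun w hw => (univMat_gen_mul_mem hw).1)
    (mem_spanStabilizer x₂_mem fun w hw => (univMat_gen_mul_mem hw).2.1)
    (mem_spanStabilizer y₀_mem fun w hw => (univMat_gen_mul_mem hw).2.2)
  have hγ : γ ∈ spanStabilizer := h ▸ Subgroup.mem_top γ
  have h1 : 1 ∈ totalSpan :=
    mem_totalSpan.2 ⟨1, Submodule.subset_span (by simp), 0, zero_mem _, by simp⟩
  simpa using (hγ 1 h1).1

theorem trace_mem_of_mem_fibreSpan {n : Matrix (Fin 2) (Fin 2) (X → ℂ)} (hn : n ∈ fibreSpan) :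
    n.trace ∈ coordAlgebra ∧ (n * univMat genT).trace ∈ coordAlgebra := by
  induction hn using Submodule.span_induction with
  | mem e he =>
    rcases he with rfl | rfl | rfl | rfl
    · rw [one_mul, trace_univMat, trace_one]
      exact ⟨natCast_mem _ _, y₀_mem⟩
    · rw [trace_univMat]
      refine ⟨x₁_mem, ?_⟩
      convert y₀_mem using 1
      ext χ
      rw [← univMat_mul, trace_univMat, y₀_apply, ← trace_AT, ← mat_mul]
      exact apply_eq_trace χ _
    · rw [trace_univMat]
      refine ⟨x₂_mem, ?_⟩
      convert y₀_mem using 1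
      ext χ
      rw [← univMat_mul, trace_univMat, y₀_apply, ← trace_BT, ← mat_mul]
      exact apply_eq_trace χ _
    · rw [univMat_AB_trace]
      refine ⟨x₁_mem, ?_⟩
      convert y₀_mem using 1
      ext χ
      rw [← univMat_mul, ← univMat_mul, trace_univMat, y₀_apply, ← trace_ABT, ← mat_mul, ← mat_mul]
      exact apply_eq_trace χ _
  | zero => simp [zero_mem]
  | add u v _ _ hu hv =>
    rw [add_mul, trace_add, trace_add]
    exact ⟨add_mem hu.1 hv.1, add_mem hu.2 hv.2⟩
  | smul r u _ hu =>
    rw [smul_mul_assoc, trace_smul, trace_smul]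
    exact ⟨mul_mem r.2 hu.1, mul_mem r.2 hu.2⟩

theorem coordAlgebra_eq : coordAlgebra = regularFunctions 2 Γ := by
  apply le_antisymm
  · refine Algebra.adjoin_mono ?_
    rintro _ (rfl | rfl | rfl) <;> exact ⟨_, rfl⟩
  · refine Algebra.adjoin_le ?_
    rintro _ ⟨γ, rfl⟩
    obtain ⟨n, hn, n', hn', h⟩ := mem_totalSpan.1 (univMat_mem_totalSpan γ)
    rw [← trace_univMat, ← h, trace_add]
    exact add_mem (trace_mem_of_mem_fibreSpan hn).1 (trace_mem_of_mem_fibreSpan hn').2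

theorem coords_injective : Function.Injective coords := by
  intro χ ψ h
  have h1 : x₁ χ = x₁ ψ := congrArg Prod.fst h
  have h2 : x₂ χ = x₂ ψ := congrArg (fun p => p.2.1) h
  have h3 : y₀ χ = y₀ ψ := congrArg (fun p => p.2.2) h
  have key : ∀ f ∈ coordAlgebra, f χ = f ψ := by
    intro f hf
    induction hf using Algebra.adjoin_induction with
    | mem f hf => rcases hf with rfl | rfl | rfl <;> assumption
    | algebraMap r => rfl
    | add f g _ _ hf hg => rw [Pi.add_apply, Pi.add_apply, hf, hg]
    | mul f g _ _ hf hg => rw [Pi.mul_apply, Pi.mul_apply, hf, hg]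
  refine Subtype.ext (funext fun γ => key (traceFun 2 γ) ?_)
  rw [coordAlgebra_eq]
  exact Algebra.subset_adjoin ⟨γ, rfl⟩

end FigureEight

/-! ### Representations realising every point of the two curves -/

namespace FigureEight

open Matrix CharacterVariety

theorem of_fin_two_congr {R : Type*} {a b c d a' b' c' d' : R} (ha : a = a') (hb : b = b')
    (hc : c = c') (hd : d = d') : !![a, b; c, d] = !![a', b'; c', d'] := by
  rw [ha, hb, hc, hd]

/-- The representation determined by matrices satisfying the relations. -/
theorem exists_rep {A B T : SL(2, ℂ)} (h1 : T * A = A * B * T) (h2 : T * B = B * A * B * T) :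
    ∃ ρ : Γ →* SL(2, ℂ), ρ genA = A ∧ ρ genB = B ∧ ρ genT = T := by
  let f : Gen → SL(2, ℂ) := fun g => match g with
    | Gen.a => A
    | Gen.b => B
    | Gen.t => T
  have hf : ∀ r ∈ rels, FreeGroup.lift f r = 1 := by
    rintro _ (rfl | rfl)
    · simp only [map_mul, map_inv, FreeGroup.lift_apply_of, f]
      rw [mul_inv_eq_one, mul_inv_eq_iff_eq_mul, h1]
    · simp only [map_mul, map_inv, FreeGroup.lift_apply_of, f]
      rw [mul_inv_eq_one, mul_inv_eq_iff_eq_mul, h2]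
  exact ⟨PresentedGroup.toGroup hf, PresentedGroup.toGroup.of hf, PresentedGroup.toGroup.of hf,
    PresentedGroup.toGroup.of hf⟩

theorem coords_ofHom (ρ : Γ →* SL(2, ℂ)) :
    coords (ofHom ρ) = ((mat ρ genA).trace, (mat ρ genB).trace, (mat ρ genT).trace) := rfl

theorem exists_coords_eq_of_reducible (y : ℂ) : ∃ χ : X, coords χ = (2, 2, y) := by
  obtain ⟨T, hT⟩ : ∃ T : SL(2, ℂ), T.1.trace = y := ⟨⟨!![0, -1; 1, y], by simp⟩, by simp⟩
  obtain ⟨ρ, ha, hb, ht⟩ := exists_rep (A := 1) (B := 1) (T := T)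
    (by rw [mul_one, mul_one, one_mul]) (by rw [mul_one, mul_one, mul_one, one_mul])
  refine ⟨ofHom ρ, ?_⟩
  rw [coords_ofHom, mat, mat, mat, ha, hb, ht, hT]
  simp

theorem exists_mul_eq_one_add_eq (y : ℂ) : ∃ m n : ℂ, m * n = 1 ∧ m + n = y := by
  obtain ⟨s, hs⟩ := IsAlgClosed.exists_pow_nat_eq (y ^ 2 - 4) two_pos
  exact ⟨(y + s) / 2, (y - s) / 2, by linear_combination -hs / 4, by ring⟩

theorem exists_coords_eq_of_curve {p : ℂ × ℂ × ℂ} (h1 : (p.1 - 1) * (p.2.1 - 1) = 1)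
    (h2 : p.2.2 ^ 2 = p.1 + p.2.1 + 1) : ∃ χ : X, coords χ = p := by
  obtain ⟨x, x', y⟩ := p
  obtain ⟨m, n, hmn, rfl⟩ := exists_mul_eq_one_add_eq y
  simp only at h1 h2
  obtain ⟨z, rfl⟩ : ∃ z, x = 2 - z := ⟨2 - x, by ring⟩
  -- This is the equation of the curve after eliminating x'.
  have hz : z ^ 2 = z * (3 - m ^ 2 - n ^ 2) + (m ^ 2 + n ^ 2 - 3) := by
    linear_combination (z - 1) * h2 - h1 + (2 - 2 * z) * hmn
  -- T is triangular with eigenvalues m, n, so its trace is y. A has determinant 1, trace 2 - z and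
  -- satisfies tr TA = tr T, as it must. B is A⁻¹TAT⁻¹ multiplied out, which the first relation
  -- forces; `hz` serves the second relation.
  let A : Matrix (Fin 2) (Fin 2) ℂ := !![1, -m; z * n, 1 - z]
  let T : Matrix (Fin 2) (Fin 2) ℂ := !![m, 1; 0, n]
  let B : Matrix (Fin 2) (Fin 2) ℂ := !![(1 - z) * (1 + z * n ^ 2) + z * n ^ 2,
    (1 - z) * (-z * n - m ^ 3 - z * m) + m - m * z - z * n;
    -z * n * (1 + z * n ^ 2) + z * n ^ 3,
    z ^ 2 * n ^ 2 + z * m ^ 2 + z ^ 2 + 1 - z - z * n ^ 2]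
  have dA : A.det = 1 := by rw [det_fin_two_of]; linear_combination z * hmn
  have dT : T.det = 1 := by rw [det_fin_two_of]; linear_combination hmn
  have dB : B.det = 1 := by rw [det_fin_two_of]; grind
  have hTA : T * A = A * B * T := by
    simp only [A, B, T, mul_fin_two]
    exact of_fin_two_congr (by grind) (by grind) (by grind) (by grind)
  have hTB : T * B = B * A * B * T := by
    simp only [A, B, T, mul_fin_two]
    exact of_fin_two_congr (by grind) (by grind) (by grind) (by grind)
  obtain ⟨ρ, ha, hb, ht⟩ := exists_rep (A := ⟨A, dA⟩) (B := ⟨B, dB⟩) (T := ⟨T, dT⟩)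
    (Subtype.ext hTA) (Subtype.ext hTB)
  have hA : (mat ρ genA).trace = 2 - z := by
    rw [mat, ha]
    simp [A, trace_fin_two]
    ring
  refine ⟨ofHom ρ, ?_⟩
  rw [coords_ofHom, hA]
  have hp := traceA_mul_traceB ρ
  rw [hA] at hp
  have hx : 2 - z - 1 ≠ 0 := left_ne_zero_of_mul_eq_one h1
  -- The trace of A already determines that of B through (x - 1)(x' - 1) = 1.
  have : (mat ρ genB).trace = x' := by
    apply mul_left_cancel₀ hx
    linear_combination hp - h1
  rw [this, mat, ht]
  simp [T, trace_fin_two]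

end FigureEight

/-! ### Zariski topology and irreducibility criteria -/

namespace CharacterVariety

variable {r : ℕ} {G : Type*} [Group G]

theorem isTopologicalBasis_zariski : TopologicalSpace.IsTopologicalBasis
    {U : Set (CharacterVariety r G) | ∃ f ∈ regularFunctions r G, U = {χ | f χ ≠ 0}} where
  exists_subset_inter := by
    rintro _ ⟨f, hf, rfl⟩ _ ⟨g, hg, rfl⟩ χ ⟨h1, h2⟩
    refine ⟨_, ⟨f * g, mul_mem hf hg, rfl⟩, mul_ne_zero h1 h2, fun ψ hψ => ?_⟩
    exact ⟨left_ne_zero_of_mul hψ, right_ne_zero_of_mul hψ⟩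
  sUnion_eq := Set.eq_univ_of_forall fun χ =>
    ⟨_, ⟨1, one_mem _, rfl⟩, show (1 : CharacterVariety r G → ℂ) χ ≠ 0 from one_ne_zero⟩
  eq_generateFrom := rfl

theorem isClosed_setOf_eq {f g : CharacterVariety r G → ℂ} (hf : f ∈ regularFunctions r G)
    (hg : g ∈ regularFunctions r G) : IsClosed {χ | f χ = g χ} := by
  rw [← isOpen_compl_iff]
  refine isTopologicalBasis_zariski.isOpen ⟨f - g, sub_mem hf hg, ?_⟩
  ext χ
  simp [sub_eq_zero]

/-- A nonempty set is irreducible if the regular functions on it have no zero divisors. -/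
theorem isIrreducible_of_mul_eq_zero {Z : Set (CharacterVariety r G)} (hZ : Z.Nonempty)
    (h : ∀ f ∈ regularFunctions r G, ∀ g ∈ regularFunctions r G, (∀ χ ∈ Z, f χ * g χ = 0) →
      (∀ χ ∈ Z, f χ = 0) ∨ ∀ χ ∈ Z, g χ = 0) : IsIrreducible Z := by
  refine ⟨hZ, ?_⟩
  rintro U V hU hV ⟨χ, hχ, hχU⟩ ⟨ψ, hψ, hψV⟩
  obtain ⟨_, ⟨f, hf, rfl⟩, hf1, hf2⟩ := isTopologicalBasis_zariski.exists_subset_of_mem_open hχU hU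
  obtain ⟨_, ⟨g, hg, rfl⟩, hg1, hg2⟩ := isTopologicalBasis_zariski.exists_subset_of_mem_open hψV hV
  by_contra hne
  rcases h f hf g hg fun θ hθ => by
    by_contra h0
    exact hne ⟨θ, hθ, hf2 (left_ne_zero_of_mul h0), hg2 (right_ne_zero_of_mul h0)⟩ with h0 | h0
  · exact hf1 (h0 χ hχ)
  · exact hg1 (h0 ψ hψ)

end CharacterVariety

theorem irreducibleComponents_eq_pair {α : Type*} [TopologicalSpace α] {C D : Set α}
    (hC : IsIrreducible C) (hD : IsIrreducible D) (hC' : IsClosed C) (hD' : IsClosed D)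
    (hCD : C ∪ D = Set.univ) (h1 : ¬ C ⊆ D) (h2 : ¬ D ⊆ C) :
    irreducibleComponents α = {C, D} := by
  have key : ∀ s : Set α, IsIrreducible s → s ⊆ C ∨ s ⊆ D := fun s hs =>
    isPreirreducible_iff_isClosed_union_isClosed.1 hs.2 C D hC' hD' (hCD ▸ Set.subset_univ s)
  ext s
  constructor
  · intro hs
    rcases key s hs.1 with h | h
    · exact Or.inl (h.antisymm (hs.2 hC h))
    · exact Or.inr (h.antisymm (hs.2 hD h))
  · rintro (rfl | rfl)
    · exact ⟨hC, fun t ht hst => (key t ht).resolve_right fun h => h1 (hst.trans h)⟩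
    · exact ⟨hD, fun t ht hst => (key t ht).resolve_left fun h => h2 (hst.trans h)⟩

namespace Polynomial

/-- For nonzero P and Q the left side has odd degree and the right side even degree. The difference
of the sides is X times the norm of P + Qy, where y² = X + X⁻¹ + 3. -/
theorem eq_zero_of_norm_eq_zero {P Q : ℂ[X]} (h : X * P ^ 2 = Q ^ 2 * (X ^ 2 + 3 * X + 1)) :
    P = 0 ∧ Q = 0 := by
  have hd : (X ^ 2 + 3 * X + 1 : ℂ[X]).natDegree = 2 := by compute_degree!
  have hne : (X ^ 2 + 3 * X + 1 : ℂ[X]) ≠ 0 := fun e => by simp [e] at hd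
  have hiff : P = 0 ↔ Q = 0 := by
    constructor
    · rintro rfl
      simpa [hne] using h.symm
    · rintro rfl
      simpa using h
  by_contra hPQ
  have hQ : Q ≠ 0 := fun e => hPQ ⟨hiff.2 e, e⟩
  have hP : P ≠ 0 := fun e => hQ (hiff.1 e)
  have := congrArg natDegree h
  rw [natDegree_mul X_ne_zero (pow_ne_zero 2 hP), natDegree_mul (pow_ne_zero 2 hQ) hne, hd,
    natDegree_pow, natDegree_pow, natDegree_X] at this
  omega

theorem eq_zero_of_forall_ne_zero {P : ℂ[X]} (h : ∀ u ≠ 0, P.eval u = 0) : P = 0 :=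
  eq_zero_of_infinite_isRoot P
    ((Set.finite_singleton (0 : ℂ)).infinite_compl.mono fun u hu => h u hu)

end Polynomial

/-! ### The two components -/

namespace FigureEight

open CharacterVariety Polynomial

/-- The characters with `x₁ = x₂ = 2`. -/
def line : Set X := {χ | x₁ χ = 2 ∧ x₂ χ = 2}

/-- The characters with `(x₁ - 1)(x₂ - 1) = 1` and `y₀² = x₁ + x₂ + 1`. -/
def curve : Set X := {χ | (x₁ χ - 1) * (x₂ χ - 1) = 1 ∧ y₀ χ ^ 2 = x₁ χ + x₂ χ + 1}

theorem x₁_mem_regular : x₁ ∈ regularFunctions 2 Γ := coordAlgebra_eq ▸ x₁_mem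

theorem x₂_mem_regular : x₂ ∈ regularFunctions 2 Γ := coordAlgebra_eq ▸ x₂_mem

theorem y₀_mem_regular : y₀ ∈ regularFunctions 2 Γ := coordAlgebra_eq ▸ y₀_mem

theorem x₁_mul_x₂ (χ : X) : (x₁ χ - 1) * (x₂ χ - 1) = 1 := by
  rw [x₁_apply, x₂_apply]
  linear_combination traceA_mul_traceB (rep χ)

theorem x₂_eq_two {χ : X} (h : x₁ χ = 2) : x₂ χ = 2 := by
  have := x₁_mul_x₂ χ
  rw [h] at this
  linear_combination this

theorem line_union_curve : line ∪ curve = Set.univ := by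
  refine Set.eq_univ_of_forall fun χ => ?_
  refine (trace_alternative (rep χ)).imp (fun h => ?_) (fun h => ?_)
  · exact ⟨(x₁_apply χ).trans h.1, (x₂_apply χ).trans h.2⟩
  · refine ⟨x₁_mul_x₂ χ, ?_⟩
    rwa [x₁_apply, x₂_apply, y₀_apply]

theorem reducibleCharacters_eq : reducibleCharacters 2 Γ = line := by
  ext χ
  constructor
  · rintro ⟨ρ, hρ, rfl⟩
    obtain ⟨v, hv, h⟩ := (not_isIrreducible_iff ρ).1 hρ
    exact trace_eq_two_of_eigenvector ρ hv h
  · rintro ⟨h1, h2⟩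
    rw [x₁_apply] at h1
    rw [x₂_apply] at h2
    exact ⟨rep χ, (not_isIrreducible_iff _).2 (exists_eigenvector _ h1 h2), eq_ofHom_rep χ⟩

theorem irreducibleCharacters_eq : irreducibleCharacters 2 Γ = curve ∩ {χ | x₁ χ ≠ 2} := by
  ext χ
  constructor
  · rintro ⟨ρ, hρ, rfl⟩
    have hne : ¬ ((mat ρ genA).trace = 2 ∧ (mat ρ genB).trace = 2) := fun h =>
      (not_isIrreducible_iff _).2 (exists_eigenvector _ h.1 h.2) hρ
    exact ⟨⟨x₁_mul_x₂ _, (trace_alternative ρ).resolve_left hne⟩,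
      fun h => hne ⟨h, x₂_eq_two h⟩⟩
  · rintro ⟨-, h⟩
    refine ⟨rep χ, ?_, eq_ofHom_rep χ⟩
    by_contra hρ
    obtain ⟨v, hv, h'⟩ := (not_isIrreducible_iff _).1 hρ
    exact h ((x₁_apply χ).trans (trace_eq_two_of_eigenvector _ hv h').1)

theorem coords_image_line : coords '' line = {p : ℂ × ℂ × ℂ | p.1 = 2 ∧ p.2.1 = 2} := by
  ext ⟨x, x', y⟩
  constructor
  · rintro ⟨χ, hχ, h⟩
    rw [← h]
    exact hχ
  · rintro ⟨rfl : x = 2, rfl : x' = 2⟩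
    obtain ⟨χ, hχ⟩ := exists_coords_eq_of_reducible y
    exact ⟨χ, ⟨congrArg Prod.fst hχ, congrArg (fun p => p.2.1) hχ⟩, hχ⟩

theorem mem_curve_iff (χ : X) : χ ∈ curve ↔ ((coords χ).1 - 1) * ((coords χ).2.1 - 1) = 1 ∧
    (coords χ).2.2 ^ 2 = (coords χ).1 + (coords χ).2.1 + 1 := Iff.rfl

theorem coords_image_curve : coords '' curve =
    {p : ℂ × ℂ × ℂ | (p.1 - 1) * (p.2.1 - 1) = 1 ∧ p.2.2 ^ 2 = p.1 + p.2.1 + 1} := by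
  ext p
  constructor
  · rintro ⟨χ, hχ, rfl⟩
    exact hχ
  · rintro ⟨h1, h2⟩
    obtain ⟨χ, rfl⟩ := exists_coords_eq_of_curve h1 h2
    exact ⟨χ, ⟨h1, h2⟩, rfl⟩

theorem ofReal_sqrt_five_sq : ((√5 : ℝ) : ℂ) ^ 2 = 5 := by
  rw [← Complex.ofReal_pow, Real.sq_sqrt (by norm_num)]
  norm_num

theorem coords_image_inter : coords '' (line ∩ curve) =
    {((2 : ℂ), (2 : ℂ), ((√5 : ℝ) : ℂ)), ((2 : ℂ), (2 : ℂ), -((√5 : ℝ) : ℂ))} := by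
  rw [Set.image_inter coords_injective, coords_image_line, coords_image_curve]
  ext ⟨x, x', y⟩
  simp only [Set.mem_inter_iff, Set.mem_ofPred_eq, Set.mem_insert_iff, Set.mem_singleton_iff,
    Prod.mk.injEq]
  constructor
  · rintro ⟨⟨rfl, rfl⟩, -, h⟩
    have : y ^ 2 = ((√5 : ℝ) : ℂ) ^ 2 := by
      rw [ofReal_sqrt_five_sq, h]
      norm_num
    simpa using sq_eq_sq_iff_eq_or_eq_neg.1 this
  · rintro (⟨rfl, rfl, rfl⟩ | ⟨rfl, rfl, rfl⟩) <;>
      simp only [neg_sq, ofReal_sqrt_five_sq] <;> norm_num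

theorem isClosed_line : IsClosed line :=
  (isClosed_setOf_eq x₁_mem_regular (algebraMap_mem _ (2 : ℂ))).inter
    (isClosed_setOf_eq x₂_mem_regular (algebraMap_mem _ (2 : ℂ)))

theorem isClosed_curve : IsClosed curve :=
  (isClosed_setOf_eq (mul_mem (sub_mem x₁_mem_regular (one_mem _))
    (sub_mem x₂_mem_regular (one_mem _))) (one_mem _)).inter
    (isClosed_setOf_eq (pow_mem y₀_mem_regular 2)
      (add_mem (add_mem x₁_mem_regular x₂_mem_regular) (one_mem _)))

theorem exists_polynomial_of_line {f : X → ℂ} (hf : f ∈ regularFunctions 2 Γ) :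
    ∃ P : ℂ[X], ∀ χ ∈ line, f χ = P.eval (y₀ χ) := by
  rw [← coordAlgebra_eq] at hf
  induction hf using Algebra.adjoin_induction with
  | mem f hf =>
    rcases hf with rfl | rfl | rfl
    · exact ⟨C 2, fun χ hχ => by simp [hχ.1]⟩
    · exact ⟨C 2, fun χ hχ => by simp [hχ.2]⟩
    · exact ⟨Polynomial.X, fun χ hχ => by simp⟩
  | algebraMap r => exact ⟨C r, fun χ _ => by simp⟩
  | add f g _ _ hf hg =>
    obtain ⟨P, hP⟩ := hf
    obtain ⟨Q, hQ⟩ := hg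
    exact ⟨P + Q, fun χ hχ => by rw [Pi.add_apply, hP χ hχ, hQ χ hχ, eval_add]⟩
  | mul f g _ _ hf hg =>
    obtain ⟨P, hP⟩ := hf
    obtain ⟨Q, hQ⟩ := hg
    exact ⟨P * Q, fun χ hχ => by rw [Pi.mul_apply, hP χ hχ, hQ χ hχ, eval_mul]⟩

theorem isIrreducible_line : IsIrreducible line := by
  have hsurj : ∀ y, ∃ χ ∈ line, y₀ χ = y := fun y => by
    obtain ⟨χ, hχ⟩ := exists_coords_eq_of_reducible y
    exact ⟨χ, ⟨congrArg Prod.fst hχ, congrArg (fun p => p.2.1) hχ⟩,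
      congrArg (fun p => p.2.2) hχ⟩
  refine isIrreducible_of_mul_eq_zero ((hsurj 0).imp fun _ h => h.1) fun f hf g hg hfg => ?_
  obtain ⟨P, hP⟩ := exists_polynomial_of_line hf
  obtain ⟨Q, hQ⟩ := exists_polynomial_of_line hg
  have : P * Q = 0 := by
    refine eq_zero_of_forall_ne_zero fun y _ => ?_
    obtain ⟨χ, hχ, rfl⟩ := hsurj y
    rw [eval_mul, ← hP χ hχ, ← hQ χ hχ, hfg χ hχ]
  rcases mul_eq_zero.1 this with h | h
  · exact Or.inl fun χ hχ => by rw [hP χ hχ, h, eval_zero]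
  · exact Or.inr fun χ hχ => by rw [hQ χ hχ, h, eval_zero]

/-- On the curve x₂ - 1 is the inverse of u = x₁ - 1, and y₀² is a Laurent polynomial in u. Up to a
power of u, every regular function is thus P(u) + Q(u)y₀. -/
theorem exists_polynomial_of_curve {f : X → ℂ} (hf : f ∈ regularFunctions 2 Γ) :
    ∃ (k : ℕ) (P Q : ℂ[X]), ∀ χ ∈ curve,
      (x₁ χ - 1) ^ k * f χ = P.eval (x₁ χ - 1) + Q.eval (x₁ χ - 1) * y₀ χ := by
  rw [← coordAlgebra_eq] at hf
  induction hf using Algebra.adjoin_induction with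
  | mem f hf =>
    rcases hf with rfl | rfl | rfl
    · exact ⟨0, Polynomial.X + 1, 0, fun χ hχ => by simp⟩
    · refine ⟨1, Polynomial.X + 1, 0, fun χ hχ => ?_⟩
      simp only [eval_add, eval_X, eval_one, eval_zero]
      linear_combination hχ.1
    · exact ⟨0, 0, 1, fun χ hχ => by simp⟩
  | algebraMap r => exact ⟨0, C r, 0, fun χ _ => by simp⟩
  | add f g _ _ hf hg =>
    obtain ⟨k, P, Q, hf⟩ := hf
    obtain ⟨l, R, S, hg⟩ := hg
    refine ⟨k + l, Polynomial.X ^ l * P + Polynomial.X ^ k * R,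
      Polynomial.X ^ l * Q + Polynomial.X ^ k * S, fun χ hχ => ?_⟩
    simp only [eval_add, eval_mul, eval_pow, eval_X, Pi.add_apply]
    linear_combination (x₁ χ - 1) ^ l * hf χ hχ + (x₁ χ - 1) ^ k * hg χ hχ
  | mul f g _ _ hf hg =>
    obtain ⟨k, P, Q, hf⟩ := hf
    obtain ⟨l, R, S, hg⟩ := hg
    -- The extra factor u clears the denominator in u y₀² = u² + 3u + 1.
    refine ⟨k + l + 1,
      Polynomial.X * (P * R) + (Polynomial.X ^ 2 + 3 * Polynomial.X + 1) * (Q * S),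
      Polynomial.X * (P * S + Q * R), fun χ hχ => ?_⟩
    have h1 := hf χ hχ
    have h2 := hg χ hχ
    obtain ⟨e1, e2⟩ := hχ
    simp only [eval_add, eval_mul, eval_pow, eval_X, eval_one, eval_ofNat, Pi.mul_apply]
    generalize eval (x₁ χ - 1) P = p at *
    generalize eval (x₁ χ - 1) Q = q at *
    generalize eval (x₁ χ - 1) R = r at *
    generalize eval (x₁ χ - 1) S = s at *
    linear_combination (x₁ χ - 1) * ((x₁ χ - 1) ^ l * g χ) * h1 +
      (x₁ χ - 1) * (p + q * y₀ χ) * h2 + (x₁ χ - 1) * q * s * e2 + q * s * e1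

theorem isIrreducible_curve : IsIrreducible curve := by
  have hsurj : ∀ u y : ℂ, u ≠ 0 → y ^ 2 = u + u⁻¹ + 3 →
      ∃ χ ∈ curve, x₁ χ = u + 1 ∧ y₀ χ = y := fun u y hu hy => by
    have h1 : (u + 1 - 1) * (u⁻¹ + 1 - 1) = 1 := by simp [hu]
    have h2 : y ^ 2 = u + 1 + (u⁻¹ + 1) + 1 := by linear_combination hy
    obtain ⟨χ, hχ⟩ := exists_coords_eq_of_curve (p := (u + 1, u⁻¹ + 1, y)) h1 h2
    exact ⟨χ, (mem_curve_iff χ).2 (hχ ▸ ⟨h1, h2⟩), congrArg Prod.fst hχ,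
      congrArg (fun p => p.2.2) hχ⟩
  have hroot : ∀ u : ℂ, ∃ y : ℂ, y ^ 2 = u + u⁻¹ + 3 := fun u =>
    IsAlgClosed.exists_pow_nat_eq _ two_pos
  have hne : curve.Nonempty := by
    obtain ⟨y, hy⟩ := hroot 1
    exact (hsurj 1 y one_ne_zero hy).imp fun _ h => h.1
  refine isIrreducible_of_mul_eq_zero hne fun f hf g hg hfg => ?_
  obtain ⟨k, P, Q, hP⟩ := exists_polynomial_of_curve hf
  obtain ⟨l, R, S, hR⟩ := exists_polynomial_of_curve hg
  -- The product of the norms of f and g, denominators cleared, vanishes at every u ≠ 0: multiply fg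
  -- = 0 by the conjugates P - Qy and R - Sy.
  have hN : (Polynomial.X * P ^ 2 - Q ^ 2 * (Polynomial.X ^ 2 + 3 * Polynomial.X + 1)) *
      (Polynomial.X * R ^ 2 - S ^ 2 * (Polynomial.X ^ 2 + 3 * Polynomial.X + 1)) = 0 := by
    refine eq_zero_of_forall_ne_zero fun u hu => ?_
    obtain ⟨y, hy⟩ := hroot u
    have key : ∀ y : ℂ, y ^ 2 = u + u⁻¹ + 3 →
        (P.eval u + Q.eval u * y) * (R.eval u + S.eval u * y) = 0 := by
      intro y hy
      obtain ⟨χ, hχ, hx, rfl⟩ := hsurj u y hu hy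
      have h1 := hP χ hχ
      have h2 := hR χ hχ
      rw [hx, add_sub_cancel_right] at h1 h2
      rw [← h1, ← h2]
      linear_combination u ^ k * u ^ l * hfg χ hχ
    have h1 := key y hy
    have h2 := key (-y) ((neg_sq y).trans hy)
    have hy' : u * y ^ 2 = u ^ 2 + 3 * u + 1 := by
      rw [hy]
      field_simp
      ring
    simp only [eval_add, eval_mul, eval_pow, eval_X, eval_one, eval_ofNat, eval_sub]
    rw [← hy']
    linear_combination u ^ 2 * (eval u P - eval u Q * y) * (eval u R - eval u S * y) * h1
  have hz : ∀ {h : X → ℂ} {m : ℕ} {P Q : ℂ[X]}, (∀ χ ∈ curve,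
      (x₁ χ - 1) ^ m * h χ = P.eval (x₁ χ - 1) + Q.eval (x₁ χ - 1) * y₀ χ) →
      Polynomial.X * P ^ 2 - Q ^ 2 * (Polynomial.X ^ 2 + 3 * Polynomial.X + 1) = 0 →
      ∀ χ ∈ curve, h χ = 0 := by
    intro h m P Q hh hPQ χ hχ
    obtain ⟨rfl, rfl⟩ := eq_zero_of_norm_eq_zero (sub_eq_zero.1 hPQ)
    have := hh χ hχ
    rw [eval_zero, zero_mul, add_zero] at this
    exact (mul_eq_zero.1 this).resolve_left (pow_ne_zero _ (left_ne_zero_of_mul_eq_one hχ.1))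
  exact (mul_eq_zero.1 hN).imp (hz hP) (hz hR)

theorem exists_mem_curve_x₁_ne : ∃ χ ∈ curve, x₁ χ ≠ 2 := by
  obtain ⟨y, hy⟩ := IsAlgClosed.exists_pow_nat_eq ((3 : ℂ) + 3 / 2 + 1) two_pos
  obtain ⟨χ, hχ⟩ := exists_coords_eq_of_curve (p := (3, 3 / 2, y)) (by norm_num) hy
  refine ⟨χ, (mem_curve_iff χ).2 (hχ ▸ ⟨by norm_num, hy⟩), ?_⟩
  rw [show x₁ χ = 3 from congrArg Prod.fst hχ]
  norm_num

/-- The irreducible characters form a nonempty open subset of the irreducible closed set `curve`,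
hence a dense one. -/
theorem curve_eq_closure : curve = closure (irreducibleCharacters 2 Γ) := by
  rw [irreducibleCharacters_eq]
  refine Set.Subset.antisymm ?_ (isClosed_curve.closure_subset_iff.2 Set.inter_subset_left)
  refine subset_closure_inter_of_isPreirreducible_of_isOpen isIrreducible_curve.2 ?_
    exists_mem_curve_x₁_ne
  exact (isClosed_setOf_eq x₁_mem_regular (algebraMap_mem _ (2 : ℂ))).isOpen_compl

theorem not_line_subset_curve : ¬ line ⊆ curve := by
  intro h
  obtain ⟨χ, hχ⟩ := exists_coords_eq_of_reducible 0
  have h1 : x₁ χ = 2 := congrArg Prod.fst hχ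
  have h2 := (h ⟨h1, x₂_eq_two h1⟩ : χ ∈ curve).2
  rw [h1, x₂_eq_two h1, show y₀ χ = 0 from congrArg (fun p => p.2.2) hχ] at h2
  norm_num at h2

theorem not_curve_subset_line : ¬ curve ⊆ line := by
  obtain ⟨χ, hχ, h⟩ := exists_mem_curve_x₁_ne
  exact fun h' => h (h' hχ).1

end FigureEight

/-! ### Tangent lines and transversality -/

namespace CharacterVariety

variable {r : ℕ} {G : Type*} [Group G]

theorem tangentSpace_apply_one {Z : Set (CharacterVariety r G)} {p : CharacterVariety r G}
    {D : Module.Dual ℂ (regularFunctions r G)} (hD : D ∈ tangentSpace Z p) : D 1 = 0 := by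
  have h := hD.1 1 1
  simp only [mul_one, OneMemClass.coe_one, Pi.one_apply, one_mul] at h
  exact left_eq_add.1 h

/-- The tangent vector to a path along which the regular functions are differentiable. -/
noncomputable def pathDerivation (φ : ℂ → CharacterVariety r G) (s : ℂ)
    (h : ∀ f ∈ regularFunctions r G, DifferentiableAt ℂ (fun u => f (φ u)) s) :
    Module.Dual ℂ (regularFunctions r G) where
  toFun f := deriv (fun u => f.1 (φ u)) s
  map_add' f g := deriv_fun_add (h f f.2) (h g g.2)
  map_smul' c f := deriv_const_mul c (h f f.2)

theorem pathDerivation_mem {Z : Set (CharacterVariety r G)} {φ : ℂ → CharacterVariety r G} {s : ℂ}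
    (h : ∀ f ∈ regularFunctions r G, DifferentiableAt ℂ (fun u => f (φ u)) s)
    (hφ : ∀ u, φ u ∈ Z) : pathDerivation φ s h ∈ tangentSpace Z (φ s) := by
  refine ⟨fun f g => ?_, fun f hf => ?_⟩
  · exact (deriv_fun_mul (h f f.2) (h g g.2)).trans (by simp [pathDerivation]; ring)
  · have : (fun u => f.1 (φ u)) = fun _ => 0 := funext fun u => hf _ (hφ u)
    exact (congrArg (deriv · s) this).trans (deriv_const s 0)

end CharacterVariety

namespace FigureEight

open CharacterVariety

theorem differentiableAt_regular {φ : ℂ → X} {s : ℂ}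
    (h1 : DifferentiableAt ℂ (fun u => x₁ (φ u)) s) (h2 : DifferentiableAt ℂ (fun u => x₂ (φ u)) s)
    (h3 : DifferentiableAt ℂ (fun u => y₀ (φ u)) s) {f : X → ℂ} (hf : f ∈ regularFunctions 2 Γ) :
    DifferentiableAt ℂ (fun u => f (φ u)) s := by
  rw [← coordAlgebra_eq] at hf
  induction hf using Algebra.adjoin_induction with
  | mem f hf => rcases hf with rfl | rfl | rfl <;> assumption
  | algebraMap r => exact differentiableAt_const r
  | add f g _ _ hf hg => exact hf.add hg
  | mul f g _ _ hf hg => exact hf.mul hg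

/-- The coordinate `x₁` as a regular function. -/
def x₁r : regularFunctions 2 Γ := ⟨x₁, x₁_mem_regular⟩

/-- The coordinate `x₂` as a regular function. -/
def x₂r : regularFunctions 2 Γ := ⟨x₂, x₂_mem_regular⟩

/-- The coordinate `y₀` as a regular function. -/
def y₀r : regularFunctions 2 Γ := ⟨y₀, y₀_mem_regular⟩

theorem exists_tangentVector {Z : Set X} {φ : ℂ → X} (hφ : ∀ u, φ u ∈ Z) {s d₁ d₂ d₃ : ℂ}
    (h1 : HasDerivAt (fun u => x₁ (φ u)) d₁ s) (h2 : HasDerivAt (fun u => x₂ (φ u)) d₂ s)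
    (h3 : HasDerivAt (fun u => y₀ (φ u)) d₃ s) :
    ∃ E ∈ tangentSpace Z (φ s), E x₁r = d₁ ∧ E x₂r = d₂ ∧ E y₀r = d₃ :=
  ⟨_, pathDerivation_mem (fun _ hf => differentiableAt_regular h1.differentiableAt
    h2.differentiableAt h3.differentiableAt hf) hφ, h1.deriv, h2.deriv, h3.deriv⟩

/-- A derivation is determined by its values on generators of the algebra. -/
theorem tangentVector_eq_zero {Z : Set X} {p : X} {E : Module.Dual ℂ (regularFunctions 2 Γ)}
    (hE : E ∈ tangentSpace Z p) (h1 : E x₁r = 0) (h2 : E x₂r = 0) (h3 : E y₀r = 0) : E = 0 := by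
  have key : ∀ f ∈ coordAlgebra, ∀ hf : f ∈ regularFunctions 2 Γ, E ⟨f, hf⟩ = 0 := by
    intro f hf
    induction hf using Algebra.adjoin_induction with
    | mem f hf => rcases hf with rfl | rfl | rfl <;> exact fun _ => by assumption
    | algebraMap r =>
      intro hf
      rw [show (⟨_, hf⟩ : regularFunctions 2 Γ) = r • 1 from
        Subtype.ext (Algebra.algebraMap_eq_smul_one r), map_smul, tangentSpace_apply_one hE,
        smul_zero]
    | add f g hf hg ef eg =>
      replace hf := coordAlgebra_eq.le hf
      replace hg := coordAlgebra_eq.le hg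
      intro hfg
      rw [show (⟨_, hfg⟩ : regularFunctions 2 Γ) = ⟨f, hf⟩ + ⟨g, hg⟩ from rfl, map_add, ef, eg,
        add_zero]
    | mul f g hf hg ef eg =>
      replace hf := coordAlgebra_eq.le hf
      replace hg := coordAlgebra_eq.le hg
      intro hfg
      rw [show (⟨_, hfg⟩ : regularFunctions 2 Γ) = ⟨f, hf⟩ * ⟨g, hg⟩ from rfl, hE.1, ef, eg,
        mul_zero, mul_zero, add_zero]
  ext f
  exact key f.1 (coordAlgebra_eq.ge f.2) f.2

theorem finrank_tangentSpace_eq_one {Z : Set X} {p : X}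
    {E : Module.Dual ℂ (regularFunctions 2 Γ)} (hE : E ∈ tangentSpace Z p) (hE0 : E ≠ 0)
    (h : ∀ D ∈ tangentSpace Z p, ∃ c : ℂ,
      D x₁r = c * E x₁r ∧ D x₂r = c * E x₂r ∧ D y₀r = c * E y₀r) :
    Module.finrank ℂ (tangentSpace Z p) = 1 := by
  refine finrank_eq_one (⟨E, hE⟩ : tangentSpace Z p) (fun e => hE0 (congrArg Subtype.val e)) ?_
  rintro ⟨D, hD⟩
  obtain ⟨c, h1, h2, h3⟩ := h D hD
  refine ⟨c, Subtype.ext (sub_eq_zero.1 (tangentVector_eq_zero (Z := Z) (p := p)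
    (sub_mem (Submodule.smul_mem _ c hE) hD) ?_ ?_ ?_))⟩ <;>
  simp [h1, h2, h3]

theorem exists_tangentVector_line {p : X} (hp : p ∈ line) :
    ∃ E ∈ tangentSpace line p, E x₁r = 0 ∧ E x₂r = 0 ∧ E y₀r = 1 := by
  choose φ hφ using exists_coords_eq_of_reducible
  have e1 : ∀ u, x₁ (φ u) = 2 := fun u => congrArg Prod.fst (hφ u)
  have e2 : ∀ u, x₂ (φ u) = 2 := fun u => congrArg (fun p => p.2.1) (hφ u)
  have e3 : ∀ u, y₀ (φ u) = u := fun u => congrArg (fun p => p.2.2) (hφ u)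
  have hp' : φ (y₀ p) = p := coords_injective ((hφ _).trans
    (Prod.ext hp.1.symm (Prod.ext hp.2.symm rfl)))
  rw [← hp']
  refine exists_tangentVector (fun u => show φ u ∈ line from ⟨e1 u, e2 u⟩) ?_ ?_ ?_
  · simp only [e1]
    exact hasDerivAt_const _ _
  · simp only [e2]
    exact hasDerivAt_const _ _
  · simp only [e3]
    exact hasDerivAt_id _

theorem exists_tangentVector_curve {p : X} (hp : p ∈ line) (hp' : p ∈ curve) :
    ∃ E ∈ tangentSpace curve p, E x₁r = 1 ∧ E x₂r = -1 ∧ E y₀r = 0 := by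
  have hy : y₀ p ^ 2 = 5 := by
    rw [hp'.2, hp.1, hp.2]
    norm_num
  -- The path has u = exp s, which is never 0, so it stays on the curve for every s. Dividing by 5 =
  -- y₀(p)² gives w(0) = 1, so the principal square root is differentiable at 0 and the path passes
  -- through p; evenness of w makes the y₀-derivative 0.
  let w : ℂ → ℂ := fun s => (Complex.exp s + Complex.exp (-s) + 3) / 5
  have hw : ∀ s, (w s ^ ((2 : ℕ) : ℂ)⁻¹) ^ 2 = w s := fun s =>
    Complex.cpow_nat_inv_pow _ two_ne_zero
  have hex : ∀ s, ∃ χ : X, coords χ = (Complex.exp s + 1, Complex.exp (-s) + 1,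
      y₀ p * w s ^ ((2 : ℕ) : ℂ)⁻¹) := fun s => by
    refine exists_coords_eq_of_curve ?_ ?_
    · simp [← Complex.exp_add]
    · simp only [mul_pow, hy, hw, w]
      ring
  choose φ hφ using hex
  have e1 : ∀ u, x₁ (φ u) = Complex.exp u + 1 := fun u => congrArg Prod.fst (hφ u)
  have e2 : ∀ u, x₂ (φ u) = Complex.exp (-u) + 1 := fun u => congrArg (fun p => p.2.1) (hφ u)
  have e3 : ∀ u, y₀ (φ u) = y₀ p * w u ^ ((2 : ℕ) : ℂ)⁻¹ := fun u =>
    congrArg (fun p => p.2.2) (hφ u)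
  have hw0 : w 0 = 1 := by
    simp only [w, neg_zero, Complex.exp_zero]
    norm_num
  have hφ0 : φ 0 = p := coords_injective ((hφ 0).trans (by
    refine Prod.ext ?_ (Prod.ext ?_ ?_)
    · rw [show (coords p).1 = 2 from hp.1, Complex.exp_zero]
      norm_num
    · rw [show (coords p).2.1 = 2 from hp.2, neg_zero, Complex.exp_zero]
      norm_num
    · rw [hw0, Complex.one_cpow, mul_one]
      rfl))
  have d1 : HasDerivAt Complex.exp 1 0 := by
    simpa using Complex.hasDerivAt_exp 0
  have d2 : HasDerivAt (fun s => Complex.exp (-s)) (-1) 0 := by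
    simpa using (hasDerivAt_neg (0 : ℂ)).cexp
  have dw : HasDerivAt w 0 0 := by
    simpa using ((d1.add d2).add_const 3).div_const 5
  rw [← hφ0]
  refine exists_tangentVector (fun u => (mem_curve_iff _).2 ?_) ?_ ?_ ?_
  · rw [hφ u]
    constructor
    · simp [← Complex.exp_add]
    · simp only [mul_pow, hy, hw, w]
      ring
  · simp only [e1]
    exact d1.add_const 1
  · simp only [e2]
    exact d2.add_const 1
  · simp only [e3]
    have := (dw.cpow_const (c := ((2 : ℕ) : ℂ)⁻¹) (by rw [hw0]; simp)).const_mul (y₀ p)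
    simpa using this

theorem finrank_tangentSpace_line {p : X} (hp : p ∈ line) :
    Module.finrank ℂ (tangentSpace line p) = 1 := by
  obtain ⟨E, hE, h1, h2, h3⟩ := exists_tangentVector_line hp
  refine finrank_tangentSpace_eq_one hE (fun e => by simp [e] at h3) fun D hD => ?_
  refine ⟨D y₀r, ?_, ?_, by rw [h3, mul_one]⟩
  · have := hD.2 (x₁r - (2 : ℂ) • 1) fun χ hχ => by simp [x₁r, hχ.1]
    rw [map_sub, map_smul, tangentSpace_apply_one hD, smul_zero, sub_zero] at this
    rw [h1, mul_zero, this]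
  · have := hD.2 (x₂r - (2 : ℂ) • 1) fun χ hχ => by simp [x₂r, hχ.2]
    rw [map_sub, map_smul, tangentSpace_apply_one hD, smul_zero, sub_zero] at this
    rw [h2, mul_zero, this]

theorem finrank_tangentSpace_curve {p : X} (hp : p ∈ line) (hp' : p ∈ curve) :
    Module.finrank ℂ (tangentSpace curve p) = 1 := by
  obtain ⟨E, hE, h1, h2, h3⟩ := exists_tangentVector_curve hp hp'
  refine finrank_tangentSpace_eq_one hE (fun e => by simp [e] at h1) fun D hD => ?_
  have hD1 := tangentSpace_apply_one hD
  -- Differentiated at x₁ = x₂ = 2, the two equations give Dx₁ + Dx₂ = 0 and 2y₀Dy₀ = Dx₁ + Dx₂.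
  -- Since y₀ ≠ 0 there, D is a multiple of (1, -1, 0).
  have r1 := hD.2 (x₁r * x₂r - x₁r - x₂r) fun χ hχ => by
    simp only [x₁r, x₂r, AddSubgroupClass.coe_sub, MulMemClass.coe_mul, Pi.sub_apply, Pi.mul_apply]
    linear_combination hχ.1
  have r2 := hD.2 (y₀r * y₀r - x₁r - x₂r - 1) fun χ hχ => by
    simp only [x₁r, x₂r, y₀r, AddSubgroupClass.coe_sub, MulMemClass.coe_mul, Pi.sub_apply,
      Pi.mul_apply, OneMemClass.coe_one, Pi.one_apply]
    linear_combination hχ.2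
  rw [map_sub, map_sub, hD.1, show x₁r.1 p = 2 from hp.1, show x₂r.1 p = 2 from hp.2] at r1
  rw [map_sub, map_sub, map_sub, hD.1, hD1, show y₀r.1 p = y₀ p from rfl] at r2
  have hy : y₀ p ≠ 0 := fun h => by
    have := hp'.2
    rw [h, hp.1, hp.2] at this
    norm_num at this
  refine ⟨D x₁r, by rw [h1, mul_one], ?_, ?_⟩
  · rw [h2]
    linear_combination r1
  · rw [h3, mul_zero]
    apply (mul_eq_zero.1 (_ : y₀ p * D y₀r = 0)).resolve_left hy
    linear_combination r2 / 2 + r1 / 2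

theorem curvesMeetTransversallyAt {p : X} (hp : p ∈ line ∩ curve) :
    CurvesMeetTransversallyAt line curve p := by
  refine ⟨hp.1, hp.2, finrank_tangentSpace_line hp.1, finrank_tangentSpace_curve hp.1 hp.2, ?_⟩
  intro h
  -- x₁ is constant on the line, yet this vector has derivative 1 along x₁.
  obtain ⟨E, hE, h1, -⟩ := exists_tangentVector_curve hp.1 hp.2
  rw [← h] at hE
  have := hE.2 (x₁r - (2 : ℂ) • 1) fun χ hχ => by simp [x₁r, hχ.1]
  rw [map_sub, map_smul, tangentSpace_apply_one hE, smul_zero, sub_zero, h1] at this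
  exact one_ne_zero this

end FigureEight

theorem proposition3p1 :
    -- the functions `x₁, x₂, y₀` are coordinates: they generate the coordinate ring and
    -- separate points
    Algebra.adjoin ℂ {FigureEight.x₁, FigureEight.x₂, FigureEight.y₀} =
        CharacterVariety.regularFunctions 2 FigureEight.Γ ∧
      Function.Injective FigureEight.coords ∧
      ∃ C D : Set FigureEight.X,
        -- there are exactly two irreducible components
        C ≠ D ∧ irreducibleComponents FigureEight.X = {C, D} ∧
        -- the component of reducible representations
        C = CharacterVariety.reducibleCharacters 2 FigureEight.Γ ∧
        FigureEight.coords '' C = {p : ℂ × ℂ × ℂ | p.1 = 2 ∧ p.2.1 = 2} ∧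
        -- the component of irreducible representations
        D = closure (CharacterVariety.irreducibleCharacters 2 FigureEight.Γ) ∧
        FigureEight.coords '' D =
          {p : ℂ × ℂ × ℂ | (p.1 - 1) * (p.2.1 - 1) = 1 ∧ p.2.2 ^ 2 = p.1 + p.2.1 + 1} ∧
        -- their intersection
        FigureEight.coords '' (C ∩ D) =
          {((2 : ℂ), (2 : ℂ), ((√5 : ℝ) : ℂ)), ((2 : ℂ), (2 : ℂ), -((√5 : ℝ) : ℂ))} ∧
        ∀ χ ∈ C ∩ D, CharacterVariety.CurvesMeetTransversallyAt C D χ := by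
  refine ⟨FigureEight.coordAlgebra_eq, FigureEight.coords_injective, FigureEight.line,
    FigureEight.curve, ?_, ?_, FigureEight.reducibleCharacters_eq.symm,
    FigureEight.coords_image_line, FigureEight.curve_eq_closure, FigureEight.coords_image_curve,
    FigureEight.coords_image_inter, fun χ hχ => FigureEight.curvesMeetTransversallyAt hχ⟩
  · exact fun h => FigureEight.not_line_subset_curve h.subset
  · exact irreducibleComponents_eq_pair FigureEight.isIrreducible_line
      FigureEight.isIrreducible_curve FigureEight.isClosed_line FigureEight.isClosed_curve
      FigureEight.line_union_curve FigureEight.not_line_subset_curve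
      FigureEight.not_curve_subset_line
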